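/- For a polynomial $g\in\mathbb{Z}[x]$ of degree $4$ and a nonzero integer $d$, consider the genus one curve $d y^2=g(x)$ (including its points at infinity, i.e. the curve $d y^2=z^4g(x/z)$ in the weighted projective plane with $x,y,z$ of weights $1,2,1$). It is called everywhere locally solvable (ELS) if it has a point over $\mathbb{R}$ and over $\mathbb{Q}_\ell$ for every prime $\ell$. Let $$H_1^d:\ d y^2=4x^4-56x^2+169,\qquad H_2^d:\ d y^2=18x^4-24x^3-32x^2+40x+34,$$ $$F_1^d:\ d y^2=11x^4+12x^3+56x^2+24x+68,\qquad F_2^d:\ d y^2=x^4+56x^2+676.$$ Let $p$ be a prime and $d=\pm p$. Then: a) $H_1^d$ is ELS if and only if $d\equiv 1\pmod{12}$ or $d=-3$. b) $H_2^d$ is ELS if and only if either $d>0$ and $d\equiv 1\pmod 8$, or $d=2$. c) $F_1^d$ is ELS if and only if $d>0$ and $d\equiv 1$ or $3\pmod 8$. d) $F_2^d$ is ELS if and only if $d>0$ and $d\equiv 1\pmod{12}$. -/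

import Mathlib

/-- A quartic `a x⁴ + b x³ + c x² + e x + f` with integer coefficients. -/
structure IntQuartic where
  a : ℤ
  b : ℤ
  c : ℤ
  e : ℤ
  f : ℤ

namespace IntQuartic

/-- The binary quartic form `a x⁴ + b x³ z + c x² z² + e x z³ + f z⁴` (the homogenization
of the quartic), evaluated in a field `K`. -/
def form (Q : IntQuartic) {K : Type*} [Field K] (x z : K) : K :=
  Q.a * x ^ 4 + Q.b * x ^ 3 * z + Q.c * x ^ 2 * z ^ 2 + Q.e * x * z ^ 3 + Q.f * z ^ 4

/-- The quadratic twist `d y² = Q(x)` has a `K`-rational point. As a genus one curve, the quartic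
is the projective model `d y² = Q(x, z)` in the weighted projective plane with `x, y, z` of
weights `1, 2, 1`, so a point is represented by `(x, y, z)` with `(x, z) ≠ (0, 0)`; the points with
`z ≠ 0` are those of the affine curve, and the points with `z = 0` are the points at infinity. -/
def TwistHasPoint (Q : IntQuartic) (d : ℤ) (K : Type*) [Field K] : Prop :=
  ∃ x y z : K, (x ≠ 0 ∨ z ≠ 0) ∧ (d : K) * y ^ 2 = Q.form x z

/-- The quadratic twist `d y² = Q(x)` is everywhere locally solvable: it has a point over every
completion of `ℚ`, that is, over `ℝ` and over `ℚ_ℓ` for every prime `ℓ`. -/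
def TwistELS (Q : IntQuartic) (d : ℤ) : Prop :=
  Q.TwistHasPoint d ℝ ∧ ∀ (l : ℕ) [Fact l.Prime], Q.TwistHasPoint d ℚ_[l]

end IntQuartic

/-- `4 x⁴ - 56 x² + 169` -/
def quarticH1 : IntQuartic := ⟨4, 0, -56, 0, 169⟩

/-- `18 x⁴ - 24 x³ - 32 x² + 40 x + 34` -/
def quarticH2 : IntQuartic := ⟨18, -24, -32, 40, 34⟩

/-- `11 x⁴ + 12 x³ + 56 x² + 24 x + 68` -/
def quarticF1 : IntQuartic := ⟨11, 12, 56, 24, 68⟩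

/-- `x⁴ + 56 x² + 676` -/
def quarticF2 : IntQuartic := ⟨1, 0, 56, 0, 676⟩

/-! At a prime l ≥ 5 not dividing d nothing obstructs solubility. Each quartic satisfies a Bezout
identity with its derivative whose constant involves only 2, 3 and 13, so for the remaining l ≥ 7
its reduction is separable. Stepanov's method then gives a point mod l, which is nonsingular and
lifts by Hensel (`twistHasPoint_of_good`). The primes 5 and 13 are finite checks.

At p = |d| the quartics are, up to a constant w, norm forms A² - cB². As d has odd valuation, a
point forces c to be a square mod p (`Padic.isSquare_zmod_of_norm_form`). The values of c are 3 for
H1; -1 and 2 for H2; -2 for F1; -1 and 3 for F2. Conversely, once these square roots lie in ℚ_p the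
quartic has a root there, hence a point with y = 0.

What remains is the sign of d, from positivity of H2, F1, F2 over ℝ, and congruences modulo powers
of 2. Explicit small points give solubility over ℝ, ℚ₂ and ℚ₃. -/

open Polynomial in
/-- Over `𝔽_p` with `p ≥ 7`, the curve `c y² = G(x)` has an affine point if `G` is nonconstant of
degree at most four and coprime to its derivative. The proof is
Stepanov's method: otherwise `G ^ ((p - 1) / 2)` is constant on `𝔽_p`. -/
theorem exists_mul_sq_eq_eval {p : ℕ} [Fact p.Prime] (hp : 7 ≤ p) (G : (ZMod p)[X])
    (hdeg : G.natDegree ≤ 4) (hunit : ¬ IsUnit G) (hcop : IsCoprime G (derivative G))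
    {c : ZMod p} (hc : c ≠ 0) : ∃ x y : ZMod p, c * y ^ 2 = G.eval x := by
  by_contra! hno
  have hp2 : p ≠ 2 := by omega
  have hpodd : 2 * (p / 2) + 1 = p := by
    have := (Fact.out : p.Prime).eq_two_or_odd
    omega
  set s := p / 2 with hs
  have hpchar : ((p : ℕ) : (ZMod p)[X]) = 0 := CharP.cast_eq_zero _ p
  have h2s : (2 : (ZMod p)[X]) * (s : (ZMod p)[X]) = -1 := by
    have : ((2 * s + 1 : ℕ) : (ZMod p)[X]) = 0 := by rw [hpodd]; exact hpchar
    push_cast at this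
    linear_combination this
  have hG0 : ∀ x, G.eval x ≠ 0 := fun x h => hno x 0 (by simp [h])
  -- With no points, c·G(x) is a nonsquare for every x, so Euler's criterion gives (c·G(x))^s = -1.
  obtain ⟨e, he⟩ : ∃ e : ZMod p, ∀ x, G.eval x ^ s = e := by
    refine ⟨-(c ^ s), fun x => ?_⟩
    have hcx : c * G.eval x ≠ 0 := mul_ne_zero hc (hG0 x)
    have hns : ¬ IsSquare (c * G.eval x) := by
      rintro ⟨r, hr⟩
      apply hno x (r / c)
      field_simp
      rw [hr]; ring
    rw [ZMod.euler_criterion p hcx] at hns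
    have h1 := (ZMod.pow_div_two_eq_neg_one_or_one p hcx).resolve_left hns
    have h2 := ZMod.pow_div_two_eq_neg_one_or_one p hc
    rw [mul_pow] at h1
    rcases h2 with h2 | h2 <;> rw [← hs] at h1 h2 <;> rw [h2] at h1 ⊢
    · simpa using h1
    · simpa using h1
  have he0 : e ≠ 0 := by rw [← he 0]; exact pow_ne_zero _ (hG0 0)
  set W : (ZMod p)[X] := X ^ p - X with hW
  have hWdeg : W.natDegree = p := FiniteField.X_pow_card_sub_X_natDegree_eq _ (by omega)
  have hW0 : W ≠ 0 := FiniteField.X_pow_card_sub_X_ne_zero _ (by omega)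
  have hWd : derivative W = -1 := by
    simp [hW, derivative_X_pow]
  obtain ⟨h, hh⟩ : W ∣ G ^ s - C e := by
    have hmon : W.Monic := monic_X_pow_sub (by simpa using (Fact.out : p.Prime).one_lt)
    rw [← modByMonic_eq_zero_iff_dvd hmon]
    refine eq_zero_of_natDegree_lt_card_of_eval_eq_zero _ (f := fun x : ZMod p => x)
      Function.injective_id (fun x => ?_) ?_
    · have := congrArg (eval x) (modByMonic_add_div (G ^ s - C e) W)
      simpa [hW, he] using this
    · rw [ZMod.card]
      refine lt_of_lt_of_eq (natDegree_modByMonic_lt _ hmon fun h => ?_) hWdeg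
      rw [h, natDegree_one] at hWdeg
      omega
  have hF : G ^ s = C e + W * h := by linear_combination hh
  -- F = G^s satisfies 2GF' = 2sG'F, and 2s = p - 1 = -1 in characteristic p. Substituting F = e +
  -- Wh with W' = -1 shows that W divides 2Gh - eG', with quotient k.
  have hode : 2 * G * derivative (G ^ s) = - derivative G * G ^ s := by
    have hs1 : s = (s - 1) + 1 := by omega
    rw [derivative_pow, map_natCast]
    conv_rhs => rw [hs1, pow_succ]
    linear_combination (G * G ^ (s - 1) * derivative G) * h2s
  rw [hF] at hode
  simp only [derivative_add, derivative_C, derivative_mul, hWd] at hode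
  set k := 2 * G * derivative h + derivative G * h with hk
  have hWk : W * k = 2 * G * h - C e * derivative G := by
    rw [hk]; linear_combination hode
  have hWk' := congrArg derivative hWk
  simp only [derivative_mul, hWd, derivative_sub, derivative_C, derivative_ofNat] at hWk'
  -- Differentiating the relation for k and eliminating h leaves a multiple of W of degree at most 6
  -- < p = deg W. It vanishes, so G divides eG'².
  have key : W * (2 * G * derivative k - derivative G * k) =
      C e * derivative G ^ 2 - C (2 * e) * (G * derivative (derivative G)) + C 4 * (G * k) := by
    have h2 : (C (2 * e) : (ZMod p)[X]) = 2 * C e := by rw [C_mul]; rfl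
    have h4 : (C 4 : (ZMod p)[X]) = 4 := rfl
    rw [h2, h4]
    linear_combination (2 * G) * hWk' - derivative G * hWk + (4 * G) * hk
  have hd1 : (derivative G).natDegree ≤ 3 := (natDegree_derivative_le G).trans (by omega)
  have hd2 : (derivative (derivative G)).natDegree ≤ 2 :=
    (natDegree_derivative_le _).trans (by omega)
  have hhdeg : h.natDegree + p ≤ 4 * s := by
    by_cases h0 : h = 0
    · rw [h0, natDegree_zero]; omega
    have : (W * h).natDegree = p + h.natDegree := by rw [natDegree_mul hW0 h0, hWdeg]
    have h3 : (W * h).natDegree ≤ 4 * s := by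
      rw [← hh]
      refine (natDegree_sub_le _ _).trans (max_le ?_ (by simp))
      exact natDegree_pow_le.trans (by nlinarith)
    omega
  have hkdeg : k.natDegree ≤ 2 := by
    by_cases h0 : k = 0
    · simp [h0]
    have h1 : (W * k).natDegree = p + k.natDegree := by rw [natDegree_mul hW0 h0, hWdeg]
    have h3 : (W * k).natDegree ≤ p + 2 := by
      rw [hWk]
      refine (natDegree_sub_le _ _).trans (max_le ?_ ?_)
      · have : (2 * G : (ZMod p)[X]) = C 2 * G := rfl
        rw [this]
        refine natDegree_mul_le.trans ?_
        have := natDegree_C_mul_le (2 : ZMod p) G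
        omega
      · exact (natDegree_C_mul_le _ _).trans (by omega)
    omega
  have hzero : C e * derivative G ^ 2 - C (2 * e) * (G * derivative (derivative G))
      + C 4 * (G * k) = 0 := by
    apply eq_zero_of_dvd_of_natDegree_lt ⟨_, key.symm⟩
    rw [hWdeg]
    refine lt_of_le_of_lt (b := 6) ?_ (by omega)
    refine (natDegree_add_le _ _).trans (max_le ((natDegree_sub_le _ _).trans (max_le ?_ ?_)) ?_)
    · exact (natDegree_C_mul_le _ _).trans (natDegree_pow_le.trans (by omega))
    · exact (natDegree_C_mul_le _ _).trans (natDegree_mul_le.trans (by omega))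
    · exact (natDegree_C_mul_le _ _).trans (natDegree_mul_le.trans (by omega))
  apply hunit
  have hdvd : G ∣ C e * derivative G ^ 2 :=
    ⟨C (2 * e) * derivative (derivative G) - C 4 * k, by linear_combination hzero⟩
  have hu : IsUnit (C e : (ZMod p)[X]) := isUnit_C.mpr he0.isUnit
  exact (hcop.pow_right (n := 2)).isUnit_of_dvd' dvd_rfl ((hu.dvd_mul_left).mp hdvd)

/-! ### Hensel lifting and squares in ℚ_l -/

open Polynomial in
theorem Padic.exists_aeval_eq_zero_of_zmod {l : ℕ} [Fact l.Prime] (P : ℤ[X]) (x : ZMod l)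
    (h0 : aeval x P = 0) (h1 : aeval x (derivative P) ≠ 0) :
    ∃ z : ℤ_[l], aeval z P = 0 ∧ PadicInt.toZMod z = x := by
  obtain ⟨a, rfl⟩ : ∃ a : ℤ_[l], PadicInt.toZMod a = x := ⟨(x.val : ℤ_[l]), by simp⟩
  have hev : ∀ (R : ℤ[X]) (b : ℤ_[l]), aeval (PadicInt.toZMod b) R = PadicInt.toZMod (aeval b R) := by
    intro R b
    rw [aeval_def, aeval_def, hom_eval₂]
    congr 1
    exact RingHom.ext_int _ _
  rw [hev] at h0 h1
  have hker : ∀ b : ℤ_[l], PadicInt.toZMod b = 0 ↔ ‖b‖ < 1 := by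
    intro b
    rw [← RingHom.mem_ker, PadicInt.ker_toZMod, IsLocalRing.mem_maximalIdeal, PadicInt.mem_nonunits]
  have hn1 : ‖aeval a (derivative P)‖ = 1 :=
    le_antisymm (PadicInt.norm_le_one _) (not_lt.mp fun h => h1 ((hker _).2 h))
  obtain ⟨z, hz, hza, -⟩ := hensels_lemma (F := P) (a := a) (by
    rw [hn1, one_pow]; exact (hker _).1 h0)
  refine ⟨z, hz, ?_⟩
  rw [hn1, ← hker, map_sub] at hza
  exact sub_eq_zero.mp hza

open Polynomial in
theorem Padic.isSquare_intCast_of_zmod {l : ℕ} [Fact l.Prime] (hl : l ≠ 2) {u : ℤ}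
    (hu : (u : ZMod l) ≠ 0) (hs : IsSquare (u : ZMod l)) : IsSquare (u : ℚ_[l]) := by
  obtain ⟨r, hr⟩ := hs
  have hr0 : r ≠ 0 := by rintro rfl; simp at hr; exact hu hr
  have h2 : (2 : ZMod l) ≠ 0 := by
    exact Ring.two_ne_zero (by rwa [ZMod.ringChar_zmod_n])
  obtain ⟨z, hz, -⟩ := exists_aeval_eq_zero_of_zmod (l := l) (X ^ 2 - C u) r
    (by simp [hr, sq]) (by
      have : aeval r (2 : ℤ[X]) = 2 := map_ofNat _ 2
      simp [this, hr0, h2])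
  refine ⟨z, ?_⟩
  have : z ^ 2 = (u : ℤ_[l]) := by simpa [sub_eq_zero] using hz
  rw [← sq, ← PadicInt.coe_intCast, ← this, PadicInt.coe_pow]

open Polynomial in
theorem Padic.isSquare_intCast_two {u : ℤ} (hu : u % 8 = 1) : IsSquare (u : ℚ_[2]) := by
  obtain ⟨z, hz, -⟩ := hensels_lemma (p := 2) (F := (X ^ 2 - C u : ℤ[X])) (a := 1) (by
    -- The derivative of X² - u at 1 has norm 1/2, so Hensel needs |1 - u| < 1/4; divisibility by 8
    -- gives at most 1/8.
    have h1 : ‖((1 - u : ℤ) : ℤ_[2])‖ ≤ (2 : ℝ) ^ (-3 : ℤ) := by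
      have := (PadicInt.norm_int_le_pow_iff_dvd (p := 2) (k := 1 - u) (n := 3)).2 (by norm_num; omega)
      simpa using this
    have h2 : ‖(2 : ℤ_[2])‖ = 2⁻¹ := by
      have := PadicInt.norm_p (p := 2)
      simpa using this
    have h3 : aeval (1 : ℤ_[2]) (X ^ 2 - C u : ℤ[X]) = ((1 - u : ℤ) : ℤ_[2]) := by simp
    have h4 : aeval (1 : ℤ_[2]) (derivative (X ^ 2 - C u : ℤ[X])) = 2 := by
      have : aeval (1 : ℤ_[2]) (2 : ℤ[X]) = 2 := map_ofNat _ 2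
      simp [this]
    rw [h3, h4, h2]
    refine h1.trans_lt (by norm_num))
  refine ⟨z, ?_⟩
  have : z ^ 2 = (u : ℤ_[2]) := by simpa [sub_eq_zero] using hz
  rw [← sq, ← PadicInt.coe_intCast, ← this, PadicInt.coe_pow]

/-! ### Passing between points over ℚ_l and points over residue rings -/

namespace IntQuartic

open Polynomial

/-- The dehomogenized quartic as a polynomial. -/
noncomputable def poly (Q : IntQuartic) : ℤ[X] :=
  C Q.a * X ^ 4 + C Q.b * X ^ 3 + C Q.c * X ^ 2 + C Q.e * X + C Q.f

theorem aeval_poly (Q : IntQuartic) {R : Type*} [CommRing R] (x : R) :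
    aeval x Q.poly = Q.a * x ^ 4 + Q.b * x ^ 3 + Q.c * x ^ 2 + Q.e * x + Q.f := by
  simp [poly]

theorem derivative_poly (Q : IntQuartic) : derivative Q.poly =
    C (4 * Q.a) * X ^ 3 + C (3 * Q.b) * X ^ 2 + C (2 * Q.c) * X + C Q.e := by
  simp only [poly, derivative_add, derivative_C_mul, derivative_X_pow, derivative_C, derivative_X,
    C_mul]
  push_cast
  simp only [map_ofNat]
  ring

theorem natDegree_poly_le (Q : IntQuartic) : Q.poly.natDegree ≤ 4 := by
  unfold poly
  compute_degree

theorem form_one (Q : IntQuartic) {K : Type*} [Field K] (x : K) :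
    Q.form x 1 = aeval x Q.poly := by
  rw [aeval_poly, form]; ring

theorem twistHasPoint_of_root {Q : IntQuartic} {d : ℤ} {K : Type*} [Field K] (x : K)
    (hx : Q.form x 1 = 0) : Q.TwistHasPoint d K :=
  ⟨x, 0, 1, Or.inr one_ne_zero, by simp [hx]⟩

theorem twistHasPoint_of_isSquare {Q : IntQuartic} {d : ℤ} (hd : d ≠ 0) {K : Type*} [Field K]
    [CharZero K] (x z m u : ℤ) (hxz : x ≠ 0 ∨ z ≠ 0)
    (h : d * (Q.a * x ^ 4 + Q.b * x ^ 3 * z + Q.c * x ^ 2 * z ^ 2 + Q.e * x * z ^ 3 + Q.f * z ^ 4)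
      = u * m ^ 2) (hu : IsSquare (u : K)) : Q.TwistHasPoint d K := by
  obtain ⟨r, hr⟩ := hu
  have hd' : (d : K) ≠ 0 := by exact_mod_cast hd
  refine ⟨x, r * m / d, z, by exact_mod_cast hxz, ?_⟩
  have h' := congrArg (Int.cast : ℤ → K) h
  push_cast at h'
  rw [form]
  field_simp
  linear_combination -h' - (m : K) ^ 2 * hr

/-- A nonsingular point mod l lifts: if y ≠ 0, fix x and lift the square root; if y = 0, lift the
simple root x of the quartic. -/
theorem twistHasPoint_of_zmod {Q : IntQuartic} {d : ℤ} {l : ℕ} [Fact l.Prime] (hl : l ≠ 2)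
    (hd : (d : ZMod l) ≠ 0) {x y : ZMod l} (h : (d : ZMod l) * y ^ 2 = aeval x Q.poly)
    (hns : y ≠ 0 ∨ aeval x (derivative Q.poly) ≠ 0) : Q.TwistHasPoint d ℚ_[l] := by
  by_cases hy : y = 0
  · obtain ⟨z, hz, -⟩ := Padic.exists_aeval_eq_zero_of_zmod Q.poly x (by rw [← h, hy]; simp)
      (hns.resolve_left (not_not.mpr hy))
    refine twistHasPoint_of_root (z : ℚ_[l]) ?_
    rw [form_one]
    rw [aeval_poly] at hz ⊢
    exact_mod_cast congrArg ((↑) : ℤ_[l] → ℚ_[l]) hz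
  · have hd0 : d ≠ 0 := by rintro rfl; simp at hd
    obtain ⟨n, rfl⟩ := ZMod.intCast_surjective x
    rw [aeval_poly] at h
    refine twistHasPoint_of_isSquare hd0 n 1 1
      (d * (Q.a * n ^ 4 + Q.b * n ^ 3 + Q.c * n ^ 2 + Q.e * n + Q.f)) (Or.inr one_ne_zero) (by ring)
      (Padic.isSquare_intCast_of_zmod hl ?_ ⟨d * y, ?_⟩)
    · push_cast
      rw [← h]
      exact mul_ne_zero hd (mul_ne_zero hd (pow_ne_zero 2 hy))
    · push_cast
      rw [← h]
      ring

/-- The Bezout identity stays nontrivial mod l and makes the reduction separable, so every affine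
point mod l is nonsingular. `hlead` keeps the reduction nonconstant. -/
theorem twistHasPoint_of_good {Q : IntQuartic} {d : ℤ} {l : ℕ} [Fact l.Prime] (hl : 7 ≤ l)
    (hd : (d : ZMod l) ≠ 0) (U V : ℤ[X]) (N : ℤ) (hUV : U * Q.poly + V * derivative Q.poly = C N)
    (hN : (N : ZMod l) ≠ 0) (hlead : (Q.a : ZMod l) ≠ 0 ∨ (Q.b : ZMod l) ≠ 0) :
    Q.TwistHasPoint d ℚ_[l] := by
  set φ := Int.castRingHom (ZMod l) with hφ
  have hev : ∀ (R : ℤ[X]) (x : ZMod l), (R.map φ).eval x = aeval x R := by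
    intro R x; rw [eval_map, aeval_def]; rfl
  have hcop : IsCoprime (Q.poly.map φ) (derivative (Q.poly.map φ)) := by
    have h := congrArg (Polynomial.map φ) hUV
    simp only [Polynomial.map_add, Polynomial.map_mul, ← derivative_map, map_C] at h
    have hu : (C (N : ZMod l)⁻¹ : (ZMod l)[X]) * C (φ N) = 1 := by
      rw [← C_mul, hφ, eq_intCast, inv_mul_cancel₀ hN, C_1]
    refine ⟨C (N : ZMod l)⁻¹ * U.map φ, C (N : ZMod l)⁻¹ * V.map φ, ?_⟩
    rw [← hu, ← h]
    ring
  have hunit : ¬ IsUnit (Q.poly.map φ) := by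
    intro hU
    have h0 := natDegree_eq_zero_of_isUnit hU
    have h4 : (Q.poly.map φ).coeff 4 = 0 := coeff_eq_zero_of_natDegree_lt (by omega)
    have h3 : (Q.poly.map φ).coeff 3 = 0 := coeff_eq_zero_of_natDegree_lt (by omega)
    rw [coeff_map] at h3 h4
    simp [poly, -map_intCast, -eq_intCast, coeff_X_pow] at h3 h4
    simp [hφ] at h3 h4
    tauto
  obtain ⟨x, y, hxy⟩ := exists_mul_sq_eq_eval hl (Q.poly.map φ)
    (natDegree_map_le.trans Q.natDegree_poly_le) hunit hcop hd
  rw [hev] at hxy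
  refine twistHasPoint_of_zmod (by omega) hd hxy ?_
  by_contra! hc
  obtain ⟨A, B, hAB⟩ := hcop
  have := congrArg (eval x) hAB
  rw [eval_add, eval_mul, eval_mul, derivative_map, hev, hev, hc.2, ← hxy, hc.1] at this
  simp at this

/-- A `ℚ_l`-point has representatives `(t : y : 1)` or `(1 : y : t)` with integral coordinates. -/
theorem TwistHasPoint.exists_padicInt {Q : IntQuartic} {d : ℤ} {l : ℕ} [Fact l.Prime]
    (hd : ¬ (l : ℤ) ^ 2 ∣ d) (h : Q.TwistHasPoint d ℚ_[l]) : ∃ t y : ℤ_[l],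
      (d : ℤ_[l]) * y ^ 2 = Q.a * t ^ 4 + Q.b * t ^ 3 + Q.c * t ^ 2 + Q.e * t + Q.f ∨
      (d : ℤ_[l]) * y ^ 2 = Q.a + Q.b * t + Q.c * t ^ 2 + Q.e * t ^ 3 + Q.f * t ^ 4 := by
  have hint : ∀ (w : ℤ_[l]) (y : ℚ_[l]), (d : ℚ_[l]) * y ^ 2 = w → ∃ y' : ℤ_[l], (y' : ℚ_[l]) = y := by
    intro w y hy
    by_contra! hc
    have h1 : 1 < ‖y‖ := by
      by_contra! h
      exact hc ⟨y, h⟩ rfl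
    have hl0 : (1 : ℝ) < l := by exact_mod_cast (Fact.out : l.Prime).one_lt
    have h2 : (l : ℝ) ≤ ‖y‖ := by
      by_contra! h
      have := (Padic.norm_le_pow_iff_norm_lt_pow_add_one y 0).2 (by simpa using h)
      simp at this
      linarith
    -- As l² does not divide d, the factor d cannot cancel the denominator of y²: a nonintegral y
    -- has |y| ≥ l, whence |d·y²| > 1.
    have h3 : (l : ℝ) ^ (-2 : ℤ) < ‖(d : ℚ_[l])‖ := by
      by_contra! h
      exact hd (by simpa using (Padic.norm_int_le_pow_iff_dvd d 2).1 (by simpa using h))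
    have h4 : ‖(d : ℚ_[l])‖ * ‖y‖ ^ 2 ≤ 1 := by
      rw [← norm_pow, ← norm_mul, hy]; exact w.2
    have h5 : (1 : ℝ) < ‖(d : ℚ_[l])‖ * ‖y‖ ^ 2 := by
      calc (1 : ℝ) = (l : ℝ) ^ (-2 : ℤ) * (l : ℝ) ^ 2 := by
            rw [zpow_neg]; norm_cast; field_simp
        _ < ‖(d : ℚ_[l])‖ * (l : ℝ) ^ 2 := by gcongr
        _ ≤ _ := by gcongr
    linarith
  obtain ⟨x, y, z, hxz, hy⟩ := h
  rw [form] at hy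
  rcases le_total ‖x‖ ‖z‖ with hle | hle
  · have hz : z ≠ 0 := by
      rintro rfl
      simp at hle
      simp [hle] at hxz
    obtain ⟨t, ht⟩ : ∃ t : ℤ_[l], (t : ℚ_[l]) = x / z :=
      ⟨⟨x / z, by rw [norm_div]; exact div_le_one_of_le₀ hle (norm_nonneg _)⟩, rfl⟩
    have hw : (d : ℚ_[l]) * (y / z ^ 2) ^ 2 =
        ((Q.a * t ^ 4 + Q.b * t ^ 3 + Q.c * t ^ 2 + Q.e * t + Q.f : ℤ_[l]) : ℚ_[l]) := by
      push_cast
      rw [ht]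
      field_simp
      linear_combination hy
    obtain ⟨y', hy'⟩ := hint _ _ hw
    refine ⟨t, y', Or.inl ?_⟩
    rw [← hy'] at hw
    apply PadicInt.ext
    push_cast at hw ⊢
    exact hw
  · have hx : x ≠ 0 := by
      rintro rfl
      simp at hle
      simp [hle] at hxz
    obtain ⟨t, ht⟩ : ∃ t : ℤ_[l], (t : ℚ_[l]) = z / x :=
      ⟨⟨z / x, by rw [norm_div]; exact div_le_one_of_le₀ hle (norm_nonneg _)⟩, rfl⟩
    have hw : (d : ℚ_[l]) * (y / x ^ 2) ^ 2 =
        ((Q.a + Q.b * t + Q.c * t ^ 2 + Q.e * t ^ 3 + Q.f * t ^ 4 : ℤ_[l]) : ℚ_[l]) := by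
      push_cast
      rw [ht]
      field_simp
      linear_combination hy
    obtain ⟨y', hy'⟩ := hint _ _ hw
    refine ⟨t, y', Or.inr ?_⟩
    rw [← hy'] at hw
    apply PadicInt.ext
    push_cast at hw ⊢
    exact hw

theorem TwistHasPoint.exists_zmod {Q : IntQuartic} {d : ℤ} {l : ℕ} [Fact l.Prime]
    (hd : ¬ (l : ℤ) ^ 2 ∣ d) (h : Q.TwistHasPoint d ℚ_[l]) (n : ℕ) : ∃ t y : ZMod (l ^ n),
      (d : ZMod (l ^ n)) * y ^ 2 = Q.a * t ^ 4 + Q.b * t ^ 3 + Q.c * t ^ 2 + Q.e * t + Q.f ∨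
      (d : ZMod (l ^ n)) * y ^ 2 = Q.a + Q.b * t + Q.c * t ^ 2 + Q.e * t ^ 3 + Q.f * t ^ 4 := by
  obtain ⟨t, y, h⟩ := h.exists_padicInt hd
  refine ⟨PadicInt.toZModPow n t, PadicInt.toZModPow n y, h.imp (fun h => ?_) (fun h => ?_)⟩ <;>
  simpa using congrArg (PadicInt.toZModPow n) h

end IntQuartic

/-- The binary form `A² - c B²` with `c` a nonresidue modulo `p` only represents elements of even
valuation over `ℚ_p`. -/
theorem Padic.eq_zero_of_sq_sub_mul_sq {p : ℕ} [Fact p.Prime] {c u : ℤ}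
    (hc : ¬ IsSquare (c : ZMod p)) (hu : (u : ZMod p) ≠ 0) {A B y : ℚ_[p]}
    (h : (p : ℚ_[p]) * u * y ^ 2 = A ^ 2 - c * B ^ 2) : A = 0 ∧ B = 0 := by
  have hker : ∀ b : ℤ_[p], PadicInt.toZMod b = 0 ↔ ‖b‖ < 1 := by
    intro b
    rw [← RingHom.mem_ker, PadicInt.ker_toZMod, IsLocalRing.mem_maximalIdeal, PadicInt.mem_nonunits]
  have hunorm : ‖(u : ℚ_[p])‖ = 1 := by
    have := (hker (u : ℤ_[p])).not.1 (by simpa using hu)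
    have h2 := PadicInt.norm_le_one (u : ℤ_[p])
    have h3 : ‖((u : ℤ_[p]) : ℚ_[p])‖ = 1 := le_antisymm h2 (not_lt.mp this)
    simpa using h3
  -- The left side has odd valuation or is zero, so it is never a unit. Dividing the form by the
  -- square of the larger of A and B then yields a square root of c mod p.
  have hval : ∀ (w : ℤ_[p]) (y : ℚ_[p]), (p : ℚ_[p]) * u * y ^ 2 = w → PadicInt.toZMod w = 0 := by
    intro w y hy
    by_contra hw
    have hw1 : ‖(w : ℚ_[p])‖ = 1 :=
      le_antisymm w.2 (not_lt.mp fun h => hw ((hker _).2 h))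
    have hy0 : y ≠ 0 := by rintro rfl; simp at hy; rw [← hy] at hw1; simp at hw1
    rw [← hy, norm_mul, norm_mul, hunorm, norm_pow, Padic.norm_p,
      Padic.norm_eq_zpow_neg_valuation hy0] at hw1
    have hp0 : (p : ℝ) ≠ 0 := by exact_mod_cast (Fact.out : p.Prime).ne_zero
    have hp1 : (1 : ℝ) < p := by exact_mod_cast (Fact.out : p.Prime).one_lt
    have h1 : (p : ℝ) ^ (-1 + -y.valuation * 2) = (p : ℝ) ^ (0 : ℤ) := by
      rw [zpow_add₀ hp0, zpow_mul, zpow_neg_one, zpow_zero]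
      rw [mul_one] at hw1
      exact_mod_cast hw1
    have := zpow_right_injective₀ (by linarith) hp1.ne' h1
    omega
  by_contra hAB
  rcases le_total ‖A‖ ‖B‖ with hle | hle
  · have hB : B ≠ 0 := by
      rintro rfl
      simp at hle
      simp [hle] at hAB
    obtain ⟨t, ht⟩ : ∃ t : ℤ_[p], (t : ℚ_[p]) = A / B :=
      ⟨⟨A / B, by rw [norm_div]; exact div_le_one_of_le₀ hle (norm_nonneg _)⟩, rfl⟩
    have := hval (t ^ 2 - c) (y / B) (by
      push_cast
      rw [ht]
      field_simp
      linear_combination h)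
    rw [map_sub, map_pow, map_intCast, sub_eq_zero] at this
    exact hc ⟨PadicInt.toZMod t, by rw [← this, sq]⟩
  · have hA : A ≠ 0 := by
      rintro rfl
      simp at hle
      simp [hle] at hAB
    obtain ⟨t, ht⟩ : ∃ t : ℤ_[p], (t : ℚ_[p]) = B / A :=
      ⟨⟨B / A, by rw [norm_div]; exact div_le_one_of_le₀ hle (norm_nonneg _)⟩, rfl⟩
    have := hval (1 - c * t ^ 2) (y / A) (by
      push_cast
      rw [ht]
      field_simp
      linear_combination h)
    rw [map_sub, map_mul, map_pow, map_intCast, map_one, sub_eq_zero] at this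
    have ht0 : PadicInt.toZMod t ≠ 0 := by intro h0; simp [h0] at this
    exact hc ⟨(PadicInt.toZMod t)⁻¹, by field_simp; exact this.symm⟩


/-! ### The quadratic character of 3, and units at primes other than 2, 3, 13 -/

theorem ZMod.isSquare_three_iff {p : ℕ} [Fact p.Prime] (hp2 : p ≠ 2) (hp3 : p ≠ 3) :
    IsSquare (3 : ZMod p) ↔ p % 12 = 1 ∨ p % 12 = 11 := by
  have hp := (Fact.out : p.Prime)
  have h2 : p % 2 = 1 := hp.eq_two_or_odd.resolve_left hp2
  have h3 : p % 3 ≠ 0 := fun h =>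
    hp3 ((Nat.prime_dvd_prime_iff_eq Nat.prime_three hp).1 (Nat.dvd_of_mod_eq_zero h)).symm
  have hcast : (p : ZMod 3) = ((p % 3 : ℕ) : ZMod 3) := by simp
  have hsq : IsSquare (p : ZMod 3) ↔ p % 3 = 1 := by
    rw [hcast]
    have : p % 3 < 3 := Nat.mod_lt _ (by norm_num)
    interval_cases p % 3 <;> first | omega | decide
  have h4 : p % 4 = 1 ∨ p % 4 = 3 := by omega
  rcases h4 with h4 | h4
  · have := ZMod.exists_sq_eq_prime_iff_of_mod_four_eq_one (p := p) (q := 3) h4 (by norm_num)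
    rw [hsq] at this
    norm_cast at this ⊢
    rw [this]; omega
  · have := ZMod.exists_sq_eq_prime_iff_of_mod_four_eq_three (p := p) (q := 3) h4 (by norm_num) hp3
    rw [hsq] at this
    norm_cast at this ⊢
    rw [this]; omega

theorem ZMod.natCast_ne_zero_of_prime_ne {l q : ℕ} (hl : l.Prime) (hq : q.Prime) (h : l ≠ q) :
    (q : ZMod l) ≠ 0 := by
  rw [Ne, ZMod.natCast_eq_zero_iff, Nat.prime_dvd_prime_iff_eq hl hq]
  exact h

theorem ZMod.two_three_thirteen_ne_zero {l : ℕ} [Fact l.Prime] (hl : 5 ≤ l) (h13 : l ≠ 13)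
    (a b c : ℕ) : ((2 ^ a * 3 ^ b * 13 ^ c : ℤ) : ZMod l) ≠ 0 := by
  have hp := (Fact.out : l.Prime)
  have h2 := natCast_ne_zero_of_prime_ne hp Nat.prime_two (by omega)
  have h3 := natCast_ne_zero_of_prime_ne hp Nat.prime_three (by omega)
  have h13 := natCast_ne_zero_of_prime_ne hp (by norm_num : Nat.Prime 13) h13
  push_cast at h2 h3 h13 ⊢
  exact mul_ne_zero (mul_ne_zero (pow_ne_zero _ h2) (pow_ne_zero _ h3)) (pow_ne_zero _ h13)

/-! ### Solubility at primes l ≥ 5 not dividing d -/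

namespace IntQuartic

open Polynomial

theorem twistHasPoint_of_forall_zmod {Q : IntQuartic} {d : ℤ} {l : ℕ} [Fact l.Prime] (hl : l ≠ 2)
    (hd : (d : ZMod l) ≠ 0)
    (h : ∀ d : ZMod l, d ≠ 0 → ∃ x y : ZMod l,
      d * y ^ 2 = Q.a * x ^ 4 + Q.b * x ^ 3 + Q.c * x ^ 2 + Q.e * x + Q.f ∧
      (y ≠ 0 ∨ 4 * Q.a * x ^ 3 + 3 * Q.b * x ^ 2 + 2 * Q.c * x + Q.e ≠ 0)) :
    Q.TwistHasPoint d ℚ_[l] := by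
  obtain ⟨x, y, hxy, hns⟩ := h d hd
  refine twistHasPoint_of_zmod hl hd (x := x) (by rw [hxy, aeval_poly]) (hns.imp_right ?_)
  intro h
  have h2 : aeval x (2 : ℤ[X]) = 2 := map_ofNat _ 2
  have h3 : aeval x (3 : ℤ[X]) = 3 := map_ofNat _ 3
  have h4 : aeval x (4 : ℤ[X]) = 4 := map_ofNat _ 4
  rw [derivative_poly]
  simpa [h2, h3, h4] using h

/-- Away from `2` and `3` the only obstruction to solubility comes from primes dividing `d`, once
the discriminant has no prime factors other than `2`, `3` and `13`. -/
theorem twistHasPoint_of_five_le {Q : IntQuartic} {d : ℤ} {l : ℕ} [Fact l.Prime] (hl : 5 ≤ l)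
    (hd : (d : ZMod l) ≠ 0) (U V : ℤ[X]) (i j k : ℕ)
    (hUV : U * Q.poly + V * derivative Q.poly = C (2 ^ i * 3 ^ j * 13 ^ k))
    (hlead : ∃ i' j' k', Q.a = 2 ^ i' * 3 ^ j' * 13 ^ k' ∨ Q.b = 2 ^ i' * 3 ^ j' * 13 ^ k')
    (h5 : ∀ d : ZMod 5, d ≠ 0 → ∃ x y : ZMod 5,
      d * y ^ 2 = Q.a * x ^ 4 + Q.b * x ^ 3 + Q.c * x ^ 2 + Q.e * x + Q.f ∧
      (y ≠ 0 ∨ 4 * Q.a * x ^ 3 + 3 * Q.b * x ^ 2 + 2 * Q.c * x + Q.e ≠ 0))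
    (h13 : ∀ d : ZMod 13, d ≠ 0 → ∃ x y : ZMod 13,
      d * y ^ 2 = Q.a * x ^ 4 + Q.b * x ^ 3 + Q.c * x ^ 2 + Q.e * x + Q.f ∧
      (y ≠ 0 ∨ 4 * Q.a * x ^ 3 + 3 * Q.b * x ^ 2 + 2 * Q.c * x + Q.e ≠ 0)) :
    Q.TwistHasPoint d ℚ_[l] := by
  by_cases hl5 : l = 5
  · subst hl5
    exact twistHasPoint_of_forall_zmod (by norm_num) hd h5
  by_cases hl13 : l = 13
  · subst hl13
    exact twistHasPoint_of_forall_zmod (by norm_num) hd h13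
  have hl6 : l ≠ 6 := by rintro rfl; exact absurd (Fact.out : Nat.Prime 6) (by norm_num)
  refine twistHasPoint_of_good (by omega) hd U V _ hUV
    (ZMod.two_three_thirteen_ne_zero hl hl13 _ _ _) ?_
  obtain ⟨i', j', k', h | h⟩ := hlead
  · exact Or.inl (h ▸ ZMod.two_three_thirteen_ne_zero hl hl13 _ _ _)
  · exact Or.inr (h ▸ ZMod.two_three_thirteen_ne_zero hl hl13 _ _ _)

end IntQuartic

open Polynomial IntQuartic

theorem quarticH1_twistHasPoint {d : ℤ} {l : ℕ} [Fact l.Prime] (hl : 5 ≤ l)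
    (hd : (d : ZMod l) ≠ 0) : quarticH1.TwistHasPoint d ℚ_[l] := by
  refine twistHasPoint_of_five_le hl hd (108 - 112 * X ^ 2) (-223 * X + 28 * X ^ 3) 2 3 2 ?_
    ⟨2, 0, 0, by norm_num [quarticH1]⟩ ?_ ?_
  · rw [derivative_poly]
    norm_num [poly, quarticH1]
    ring
  · unfold quarticH1; decide
  · unfold quarticH1; decide

theorem quarticH2_twistHasPoint {d : ℤ} {l : ℕ} [Fact l.Prime] (hl : 5 ≤ l)
    (hd : (d : ZMod l) ≠ 0) : quarticH2.TwistHasPoint d ℚ_[l] := by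
  refine twistHasPoint_of_five_le hl hd (26288 - 66852 * X + 37008 * X ^ 2)
    (-19607 - 835 * X + 19797 * X ^ 2 - 9252 * X ^ 3) 3 4 2 ?_
    ⟨1, 2, 0, by norm_num [quarticH2]⟩ ?_ ?_
  · rw [derivative_poly]
    norm_num [poly, quarticH2]
    ring
  · unfold quarticH2; decide
  · unfold quarticH2; decide

theorem quarticF1_twistHasPoint {d : ℤ} {l : ℕ} [Fact l.Prime] (hl : 5 ≤ l)
    (hd : (d : ZMod l) ≠ 0) : quarticF1.TwistHasPoint d ℚ_[l] := by
  refine twistHasPoint_of_five_le hl hd (11028 + 16712 * X - 10604 * X ^ 2)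
    (-12994 + 2260 * X - 3455 * X ^ 2 + 2651 * X ^ 3) 5 4 2 ?_
    -- The leading coefficient 11 vanishes mod 11, so the cubic coefficient 12 = 2² · 3 serves
    -- instead.
    ⟨2, 1, 0, by norm_num [quarticF1]⟩ ?_ ?_
  · rw [derivative_poly]
    norm_num [poly, quarticF1]
    ring
  · unfold quarticF1; decide
  · unfold quarticF1; decide

theorem quarticF2_twistHasPoint {d : ℤ} {l : ℕ} [Fact l.Prime] (hl : 5 ≤ l)
    (hd : (d : ZMod l) ≠ 0) : quarticF2.TwistHasPoint d ℚ_[l] := by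
  refine twistHasPoint_of_five_le hl hd (108 + 28 * X ^ 2) (-223 * X - 7 * X ^ 3) 4 3 2 ?_
    ⟨0, 0, 0, by norm_num [quarticF2]⟩ ?_ ?_
  · rw [derivative_poly]
    norm_num [poly, quarticF2]
    ring
  · unfold quarticF2; decide
  · unfold quarticF2; decide


/-! ### Obstructions at p, at 2 and over ℝ -/

open IntQuartic

theorem intCast_zmod_ne_zero_of_natAbs_prime {p l : ℕ} (hp : p.Prime) (hl : l.Prime) {d : ℤ}
    (hd : d.natAbs = p) (h : l ≠ p) : (d : ZMod l) ≠ 0 := by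
  rw [Ne, ZMod.intCast_zmod_eq_zero_iff_dvd, Int.natCast_dvd, hd, Nat.prime_dvd_prime_iff_eq hl hp]
  exact h

/-- The sign of d is absorbed into the unit w. The condition that A and B are not both zero has to
be checked for each quartic from (x, z) ≠ (0, 0). -/
theorem Padic.isSquare_zmod_of_norm_form {p : ℕ} [Fact p.Prime] {d : ℤ} (hd : d.natAbs = p)
    {c w : ℤ} (hw : (w : ZMod p) ≠ 0) {A B y : ℚ_[p]} (hAB : A ≠ 0 ∨ B ≠ 0)
    (h : (d : ℚ_[p]) * w * y ^ 2 = A ^ 2 - c * B ^ 2) : IsSquare (c : ZMod p) := by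
  by_contra hc
  have : A = 0 ∧ B = 0 := by
    rcases Int.natAbs_eq d with h' | h' <;> rw [hd] at h'
    · refine eq_zero_of_sq_sub_mul_sq hc hw (y := y) ?_
      rw [← h, h']
      push_cast
      ring
    · refine eq_zero_of_sq_sub_mul_sq hc (u := -w) (by simpa using hw) (y := y) ?_
      rw [← h, h']
      push_cast
      ring
  tauto

section Necessity

variable {p : ℕ} [Fact p.Prime] {d : ℤ}

theorem quarticH1_isSquare_three (hd : d.natAbs = p) (h : quarticH1.TwistHasPoint d ℚ_[p]) :
    IsSquare (3 : ZMod p) := by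
  obtain ⟨x, y, z, hxz, h⟩ := h
  have := Padic.isSquare_zmod_of_norm_form hd (c := 3) (w := 1) (by simp)
    (A := 2 * x ^ 2 + 13 * z ^ 2) (B := 6 * x * z) (y := y) (by
      by_contra! hc
      obtain ⟨h1, h2⟩ := hc
      simp at h2
      rcases h2 with rfl | rfl <;> simp at h1 <;> simp [h1] at hxz) (by
      rw [Int.cast_one, mul_one, h]
      simp only [form, quarticH1]
      push_cast
      ring)
  exact_mod_cast this

theorem quarticH2_isSquare_neg_one (hp : p ≠ 2) (hd : d.natAbs = p)
    (h : quarticH2.TwistHasPoint d ℚ_[p]) : IsSquare (-1 : ZMod p) := by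
  obtain ⟨x, y, z, hxz, h⟩ := h
  -- H2 = 2(A² + B²); halving y moves the factor 2 to the side of d.
  have := Padic.isSquare_zmod_of_norm_form hd (c := -1) (w := 2)
    (by exact_mod_cast ZMod.natCast_ne_zero_of_prime_ne Fact.out Nat.prime_two hp)
    (A := 3 * x ^ 2 - 2 * x * z - 4 * z ^ 2) (B := 2 * x * z + z ^ 2) (y := y / 2) (by
      by_contra! hc
      obtain ⟨h1, h2⟩ := hc
      have h2 : z * (2 * x + z) = 0 := by linear_combination h2
      rcases mul_eq_zero.1 h2 with rfl | h3
      · simp at h1; simp [h1] at hxz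
      · obtain rfl : z = -2 * x := by linear_combination h3
        have : x ^ 2 = 0 := by linear_combination (-1 / 9) * h1
        simp at this; simp [this] at hxz) (by
      simp only [form, quarticH2] at h
      push_cast at h ⊢
      linear_combination h / 2)
  exact_mod_cast this

theorem quarticH2_isSquare_two (hp : p ≠ 2) (hd : d.natAbs = p)
    (h : quarticH2.TwistHasPoint d ℚ_[p]) : IsSquare (2 : ZMod p) := by
  obtain ⟨x, y, z, hxz, h⟩ := h
  have := Padic.isSquare_zmod_of_norm_form hd (c := 2) (w := 2)
    (by exact_mod_cast ZMod.natCast_ne_zero_of_prime_ne Fact.out Nat.prime_two hp)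
    (A := 3 * x ^ 2 - 2 * x * z + 5 * z ^ 2) (B := 5 * x * z - 2 * z ^ 2) (y := y / 2) (by
      by_contra! hc
      obtain ⟨h1, h2⟩ := hc
      have h2 : z * (5 * x - 2 * z) = 0 := by linear_combination h2
      rcases mul_eq_zero.1 h2 with rfl | h3
      · simp at h1; simp [h1] at hxz
      · obtain rfl : z = 5 / 2 * x := by linear_combination (-1 / 2) * h3
        have : x ^ 2 = 0 := by linear_combination (4 / 117) * h1
        simp at this; simp [this] at hxz) (by
      simp only [form, quarticH2] at h
      push_cast at h ⊢
      linear_combination h / 2)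
  exact_mod_cast this

theorem quarticF1_isSquare_neg_two (hp : p ≠ 11) (hd : d.natAbs = p)
    (h : quarticF1.TwistHasPoint d ℚ_[p]) : IsSquare (-2 : ZMod p) := by
  obtain ⟨x, y, z, hxz, h⟩ := h
  -- Completing the square gives 11·F1 = A² + 2B², which is why p = 11 is set aside.
  have := Padic.isSquare_zmod_of_norm_form hd (c := -2) (w := 11)
    (by exact_mod_cast ZMod.natCast_ne_zero_of_prime_ne Fact.out (by norm_num : Nat.Prime 11) hp)
    (A := 11 * x ^ 2 + 6 * x * z + 26 * z ^ 2) (B := 2 * x * z - 6 * z ^ 2) (y := y) (by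
      by_contra! hc
      obtain ⟨h1, h2⟩ := hc
      have h2 : z * (x - 3 * z) = 0 := by linear_combination h2 / 2
      rcases mul_eq_zero.1 h2 with rfl | h3
      · simp at h1; simp [h1] at hxz
      · obtain rfl : x = 3 * z := by linear_combination h3
        have : z ^ 2 = 0 := by linear_combination (1 / 143) * h1
        simp at this; simp [this] at hxz) (by
      simp only [form, quarticF1] at h
      push_cast at h ⊢
      linear_combination 11 * h)
  exact_mod_cast this

theorem quarticF2_isSquare_neg_one (hd : d.natAbs = p)
    (h : quarticF2.TwistHasPoint d ℚ_[p]) : IsSquare (-1 : ZMod p) := by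
  obtain ⟨x, y, z, hxz, h⟩ := h
  have := Padic.isSquare_zmod_of_norm_form hd (c := -1) (w := 1) (by simp)
    (A := x ^ 2 + 26 * z ^ 2) (B := 2 * x * z) (y := y) (by
      by_contra! hc
      obtain ⟨h1, h2⟩ := hc
      simp at h2
      rcases h2 with rfl | rfl <;> simp at h1 <;> simp [h1] at hxz) (by
      simp only [form, quarticF2] at h
      push_cast at h ⊢
      linear_combination h)
  exact_mod_cast this

theorem quarticF2_isSquare_three (hd : d.natAbs = p)
    (h : quarticF2.TwistHasPoint d ℚ_[p]) : IsSquare (3 : ZMod p) := by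
  obtain ⟨x, y, z, hxz, h⟩ := h
  have := Padic.isSquare_zmod_of_norm_form hd (c := 3) (w := 1) (by simp)
    (A := x ^ 2 + 28 * z ^ 2) (B := 6 * z ^ 2) (y := y) (by
      by_contra! hc
      obtain ⟨h1, h2⟩ := hc
      simp at h2
      subst h2
      simp at h1
      simp [h1] at hxz) (by
      simp only [form, quarticF2] at h
      push_cast at h ⊢
      linear_combination h)
  exact_mod_cast this

theorem not_two_sq_dvd_of_natAbs_prime (hd : d.natAbs = p) : ¬ ((2 : ℕ) : ℤ) ^ 2 ∣ d := by
  intro h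
  have h4 : 4 ∣ p := by
    rw [← hd]
    exact Int.natCast_dvd.mp (by simpa using h)
  have hp := (Fact.out : p.Prime)
  rcases (Nat.dvd_prime hp).1 ((by norm_num : 2 ∣ 4).trans h4) with h | h
  · omega
  · omega

theorem quarticH1_mod_four (hd : d.natAbs = p) (h : quarticH1.TwistHasPoint d ℚ_[2]) :
    d % 4 = 1 := by
  have h2 := not_two_sq_dvd_of_natAbs_prime hd
  obtain ⟨t, y, h⟩ := h.exists_zmod h2 4
  -- The values are 1 mod 4 or, for even t in the second chart, 4 mod 16. Hence D is 1 mod 4 unless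
  -- 4 divides D, and the factor 4 expresses this inside ℤ/16.
  have key : ∀ t y D : ZMod (2 ^ 4), (D * y ^ 2 = 4 * t ^ 4 - 56 * t ^ 2 + 169 ∨
      D * y ^ 2 = 4 - 56 * t ^ 2 + 169 * t ^ 4) → 4 * D = 4 ∨ 4 * D = 0 := by
    decide
  have := key t y d (by
    simp only [quarticH1] at h
    push_cast at h
    refine h.imp (fun h => ?_) (fun h => ?_) <;> rw [h] <;> ring)
  rcases this with h | h
  · have h' : ((4 * d - 4 : ℤ) : ZMod (2 ^ 4)) = 0 := by push_cast; rw [h]; ring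
    rw [ZMod.intCast_zmod_eq_zero_iff_dvd] at h'
    norm_num at h'
    omega
  · have h' : ((4 * d : ℤ) : ZMod (2 ^ 4)) = 0 := by push_cast; rw [h]
    rw [ZMod.intCast_zmod_eq_zero_iff_dvd] at h'
    norm_num at h' h2
    omega

/-- In both charts the values are odd or 4 mod 8, whereas 2y² is 0 or 2 mod 8. The same holds for
F2. -/
theorem quarticF1_not_twistHasPoint_two : ¬ quarticF1.TwistHasPoint 2 ℚ_[2] := by
  intro h
  obtain ⟨t, y, h⟩ := h.exists_zmod (by norm_num) 3
  simp only [quarticF1] at h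
  push_cast at h
  revert t y
  decide

theorem quarticF2_not_twistHasPoint_two : ¬ quarticF2.TwistHasPoint 2 ℚ_[2] := by
  intro h
  obtain ⟨t, y, h⟩ := h.exists_zmod (by norm_num) 3
  simp only [quarticF2] at h
  push_cast at h
  revert t y
  decide

theorem quarticH2_pos (h : quarticH2.TwistHasPoint d ℝ) : 0 < d := by
  obtain ⟨x, y, z, hxz, h⟩ := h
  by_contra! hc
  have hd' : (d : ℝ) ≤ 0 := by exact_mod_cast hc
  simp only [form, quarticH2] at h
  push_cast at h
  have h1 : (3 * x ^ 2 - 2 * x * z - 4 * z ^ 2) ^ 2 + (z * (2 * x + z)) ^ 2 ≤ 0 := by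
    nlinarith [mul_nonneg (neg_nonneg.2 hd') (sq_nonneg y)]
  have h2 : z * (2 * x + z) = 0 := by
    have : (z * (2 * x + z)) ^ 2 = 0 := le_antisymm
      (by nlinarith [sq_nonneg (3 * x ^ 2 - 2 * x * z - 4 * z ^ 2)]) (sq_nonneg _)
    exact pow_eq_zero_iff two_ne_zero |>.1 this
  have h3 : 3 * x ^ 2 - 2 * x * z - 4 * z ^ 2 = 0 := by
    have : (3 * x ^ 2 - 2 * x * z - 4 * z ^ 2) ^ 2 = 0 := le_antisymm
      (by nlinarith [sq_nonneg (z * (2 * x + z))]) (sq_nonneg _)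
    exact pow_eq_zero_iff two_ne_zero |>.1 this
  rcases mul_eq_zero.1 h2 with rfl | h4
  · simp at h3; simp [h3] at hxz
  · obtain rfl : z = -2 * x := by linear_combination h4
    have : x ^ 2 = 0 := by linear_combination (-1 / 9) * h3
    simp at this; simp [this] at hxz

theorem quarticF1_pos (h : quarticF1.TwistHasPoint d ℝ) : 0 < d := by
  obtain ⟨x, y, z, hxz, h⟩ := h
  by_contra! hc
  have hd' : (d : ℝ) ≤ 0 := by exact_mod_cast hc
  simp only [form, quarticF1] at h
  push_cast at h
  have h0 : 0 < x ^ 2 + z ^ 2 := by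
    rcases hxz with h | h <;> have := sq_pos_of_ne_zero h <;> positivity
  have h1 : 0 < x ^ 2 + 2 * z ^ 2 := by nlinarith [sq_nonneg z]
  have h2 : 0 < 11 * x ^ 2 + 12 * x * z + 34 * z ^ 2 := by
    nlinarith [sq_nonneg (x + z), sq_nonneg x, sq_nonneg z]
  -- F1 is the product of these two positive definite quadratic forms.
  have := mul_pos h1 h2
  nlinarith [mul_nonneg (neg_nonneg.2 hd') (sq_nonneg y)]

theorem quarticF2_pos (h : quarticF2.TwistHasPoint d ℝ) : 0 < d := by
  obtain ⟨x, y, z, hxz, h⟩ := h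
  by_contra! hc
  have hd' : (d : ℝ) ≤ 0 := by exact_mod_cast hc
  simp only [form, quarticF2] at h
  push_cast at h
  have h0 : 0 < x ^ 4 + z ^ 4 := by
    rcases hxz with h | h <;> positivity
  have h1 : 0 ≤ x ^ 2 * z ^ 2 := by positivity
  have h2 : 0 ≤ z ^ 4 := by positivity
  nlinarith [mul_nonneg (neg_nonneg.2 hd') (sq_nonneg y)]

end Necessity

/-! ### Local points from explicit values and from roots over ℚ_p -/

section Sufficiency

variable {p : ℕ} [Fact p.Prime] {d : ℤ}

/-- A twist with a point over `ℝ`, `ℚ₂`, `ℚ₃` and `ℚ_p`, `p = |d|`, is everywhere locally solvable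
if all other primes are unobstructed. -/
theorem IntQuartic.twistELS_of_local {Q : IntQuartic} (hd : d.natAbs = p)
    (hgood : ∀ (l : ℕ) [Fact l.Prime], 5 ≤ l → (d : ZMod l) ≠ 0 → Q.TwistHasPoint d ℚ_[l])
    (hreal : Q.TwistHasPoint d ℝ) (h2 : Q.TwistHasPoint d ℚ_[2]) (h3 : Q.TwistHasPoint d ℚ_[3])
    (hp : Q.TwistHasPoint d ℚ_[p]) : Q.TwistELS d := by
  refine ⟨hreal, fun l hl => ?_⟩
  by_cases hl2 : l = 2
  · subst hl2; exact h2
  by_cases hl3 : l = 3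
  · subst hl3; exact h3
  by_cases hlp : l = p
  · subst hlp; exact hp
  have := hl.out.two_le
  have hl4 : l ≠ 4 := by rintro rfl; exact absurd hl.out (by norm_num)
  exact hgood l (by omega) (intCast_zmod_ne_zero_of_natAbs_prime Fact.out hl.out hd hlp)

theorem Padic.isSquare_intCast_three {u : ℤ} (hu : u % 3 = 1) : IsSquare (u : ℚ_[3]) := by
  have h : (u : ZMod 3) = 1 := by
    have : ((u - 1 : ℤ) : ZMod 3) = 0 := by
      rw [ZMod.intCast_zmod_eq_zero_iff_dvd]; push_cast; omega
    push_cast at this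
    linear_combination this
  exact isSquare_intCast_of_zmod (by norm_num) (by rw [h]; decide) (by rw [h]; exact ⟨1, rfl⟩)

theorem Padic.isSquare_three (hp2 : p ≠ 2) (hp3 : p ≠ 3) (h : p % 12 = 1 ∨ p % 12 = 11) :
    IsSquare (3 : ℚ_[p]) := by
  have := isSquare_intCast_of_zmod (l := p) (u := 3) hp2
    (by exact_mod_cast ZMod.natCast_ne_zero_of_prime_ne Fact.out Nat.prime_three hp3)
    (by simpa using (ZMod.isSquare_three_iff hp2 hp3).2 h)
  simpa using this

theorem Padic.isSquare_neg_one (hp2 : p ≠ 2) (h : p % 4 = 1) : IsSquare (-1 : ℚ_[p]) := by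
  have := isSquare_intCast_of_zmod (l := p) (u := -1) hp2 (by simp)
    (by simpa using ZMod.exists_sq_eq_neg_one_iff.2 (by omega))
  simpa using this

theorem Padic.isSquare_two (hp2 : p ≠ 2) (h : p % 8 = 1 ∨ p % 8 = 7) : IsSquare (2 : ℚ_[p]) := by
  have := isSquare_intCast_of_zmod (l := p) (u := 2) hp2
    (by exact_mod_cast ZMod.natCast_ne_zero_of_prime_ne Fact.out Nat.prime_two hp2)
    (by simpa using (ZMod.exists_sq_eq_two_iff hp2).2 h)
  simpa using this

theorem Padic.isSquare_neg_two (hp2 : p ≠ 2) (h : p % 8 = 1 ∨ p % 8 = 3) :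
    IsSquare (-2 : ℚ_[p]) := by
  have := isSquare_intCast_of_zmod (l := p) (u := -2) hp2
    (by simpa using ZMod.natCast_ne_zero_of_prime_ne Fact.out Nat.prime_two hp2)
    (by simpa using (ZMod.exists_sq_eq_neg_two_iff hp2).2 h)
  simpa using this

theorem IntQuartic.twistHasPoint_real {Q : IntQuartic} {d : ℤ} (hd : d ≠ 0) (x z : ℤ)
    (hxz : x ≠ 0 ∨ z ≠ 0) (h : 0 ≤ d *
      (Q.a * x ^ 4 + Q.b * x ^ 3 * z + Q.c * x ^ 2 * z ^ 2 + Q.e * x * z ^ 3 + Q.f * z ^ 4)) :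
    Q.TwistHasPoint d ℝ :=
  twistHasPoint_of_isSquare hd x z 1 (d *
    (Q.a * x ^ 4 + Q.b * x ^ 3 * z + Q.c * x ^ 2 * z ^ 2 + Q.e * x * z ^ 3 + Q.f * z ^ 4)) hxz
    (by ring) (by
    rw [Real.isSquare_iff]; exact_mod_cast h)

theorem quarticH1_twistELS (hd : d.natAbs = p) (h : d % 12 = 1 ∨ d = -3) :
    quarticH1.TwistELS d := by
  have hp := (Fact.out : p.Prime)
  have hd0 : d ≠ 0 := by omega
  have h3 : quarticH1.TwistHasPoint d ℚ_[3] := by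
    rcases h with h | rfl
    · exact twistHasPoint_of_isSquare hd0 0 1 13 d (by norm_num) (by norm_num [quarticH1])
        (Padic.isSquare_intCast_three (by omega))
    · exact twistHasPoint_of_isSquare hd0 5 1 9 (-47) (by norm_num) (by norm_num [quarticH1])
        (Padic.isSquare_intCast_three (by norm_num))
  refine twistELS_of_local hd (fun l _ => quarticH1_twistHasPoint) ?_ ?_ h3 ?_
  · rcases hd0.lt_or_gt with h | h
    · exact twistHasPoint_real hd0 3 1 (by norm_num) (by norm_num [quarticH1]; omega)
    · exact twistHasPoint_real hd0 0 1 (by norm_num) (by norm_num [quarticH1]; omega)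
  · have : d % 8 = 1 ∨ d % 8 = 5 := by omega
    rcases this with h | h
    · exact twistHasPoint_of_isSquare hd0 0 1 13 d (by norm_num) (by norm_num [quarticH1])
        (Padic.isSquare_intCast_two h)
    · exact twistHasPoint_of_isSquare hd0 1 1 1 (d * 117) (by norm_num) (by norm_num [quarticH1])
        (Padic.isSquare_intCast_two (by omega))
  · by_cases hp3 : p = 3
    · subst hp3; exact h3
    obtain ⟨r, hr⟩ := Padic.isSquare_three (p := p) (by omega) hp3 (by omega)
    -- The roots of H1 satisfy x² = 7 ± 3√3/2, and 28 + 6√3 = (1 + 3√3)².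
    refine twistHasPoint_of_root ((1 + 3 * r) / 2) ?_
    simp only [form, quarticH1]
    push_cast
    linear_combination (-9 / 2 * ((9 * r ^ 2 - 27) / 2 + 2 + 6 * r)) * hr

theorem quarticH2_twistELS (hd : d.natAbs = p) (h : (0 < d ∧ d % 8 = 1) ∨ d = 2) :
    quarticH2.TwistELS d := by
  have hp := (Fact.out : p.Prime)
  have hd0 : d ≠ 0 := by omega
  have h2 : quarticH2.TwistHasPoint d ℚ_[2] := by
    rcases h with ⟨-, h⟩ | rfl
    · exact twistHasPoint_of_isSquare hd0 1 1 6 d (by norm_num) (by norm_num [quarticH2])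
        (Padic.isSquare_intCast_two h)
    · exact twistHasPoint_of_isSquare hd0 1 0 6 1 (by norm_num) (by norm_num [quarticH2]) (by simp)
  have h3 : quarticH2.TwistHasPoint d ℚ_[3] := by
    have : d % 3 ≠ 0 := by
      intro h0
      have : 3 ∣ p := by omega
      have := (Nat.prime_dvd_prime_iff_eq Nat.prime_three hp).1 this
      omega
    have : d % 3 = 1 ∨ d % 3 = 2 := by omega
    rcases this with h | h
    · exact twistHasPoint_of_isSquare hd0 1 1 6 d (by norm_num) (by norm_num [quarticH2])
        (Padic.isSquare_intCast_three h)
    · exact twistHasPoint_of_isSquare hd0 1 0 3 (d * 2) (by norm_num)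
        (by norm_num [quarticH2]; ring) (Padic.isSquare_intCast_three (by omega))
  refine twistELS_of_local hd (fun l _ => quarticH2_twistHasPoint) ?_ h2 h3 ?_
  · exact twistHasPoint_real hd0 1 1 (by norm_num) (by norm_num [quarticH2]; omega)
  · by_cases hp2 : p = 2
    · subst hp2; exact h2
    obtain ⟨s, hs⟩ := Padic.isSquare_two (p := p) hp2 (by omega)
    obtain ⟨i, hi⟩ := Padic.isSquare_neg_one (p := p) hp2 (by omega)
    -- Over ℚ(i), H2 has the factor 3x² - 2x - 4 + i(2x + 1), whose discriminant 48 - 20i equals 2(5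
    -- - i)².
    obtain ⟨x, hx⟩ : ∃ x, x = (1 - i + s * (5 - i) / 2) / 3 := ⟨_, rfl⟩
    have hfac : 3 * x ^ 2 - 2 * x - 4 + i * (2 * x + 1) = 0 := by
      rw [hx]
      linear_combination (-(25 - 10 * i + i ^ 2) / 12) * hs + hi / 6
    refine twistHasPoint_of_root x ?_
    simp only [form, quarticH2]
    push_cast
    linear_combination 2 * (3 * x ^ 2 - 2 * x - 4 - i * (2 * x + 1)) * hfac
      - 2 * (2 * x + 1) ^ 2 * hi

theorem quarticF1_twistELS (hd : d.natAbs = p) (h0 : 0 < d) (h : d % 8 = 1 ∨ d % 8 = 3) :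
    quarticF1.TwistELS d := by
  have hp := (Fact.out : p.Prime)
  have hd0 : d ≠ 0 := by omega
  have hroot : quarticF1.TwistHasPoint d ℚ_[p] := by
    obtain ⟨r, hr⟩ := Padic.isSquare_neg_two (p := p) (by omega) (by omega)
    -- F1 = (x² + 2)(11x² + 12x + 34), so a square root of -2 is a root.
    refine twistHasPoint_of_root r ?_
    simp only [form, quarticF1]
    push_cast
    linear_combination -(11 * r ^ 2 + 12 * r + 34) * hr
  refine twistELS_of_local hd (fun l _ => quarticF1_twistHasPoint) ?_ ?_ ?_ hroot
  · exact twistHasPoint_real hd0 0 1 (by norm_num) (by norm_num [quarticF1]; omega)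
  · rcases h with h | h
    · exact twistHasPoint_of_isSquare hd0 0 1 2 (d * 17) (by norm_num)
        (by norm_num [quarticF1]; ring) (Padic.isSquare_intCast_two (by omega))
    · exact twistHasPoint_of_isSquare hd0 1 1 3 (d * 19) (by norm_num)
        (by norm_num [quarticF1]; ring) (Padic.isSquare_intCast_two (by omega))
  · by_cases hp3 : p = 3
    · subst hp3; exact hroot
    have : d % 3 ≠ 0 := by
      intro h0
      have : 3 ∣ p := by omega
      have := (Nat.prime_dvd_prime_iff_eq Nat.prime_three hp).1 this
      omega
    have : d % 3 = 1 ∨ d % 3 = 2 := by omega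
    rcases this with h | h
    · exact twistHasPoint_of_isSquare hd0 1 1 3 (d * 19) (by norm_num)
        (by norm_num [quarticF1]; ring) (Padic.isSquare_intCast_three (by omega))
    · exact twistHasPoint_of_isSquare hd0 0 1 2 (d * 17) (by norm_num)
        (by norm_num [quarticF1]; ring) (Padic.isSquare_intCast_three (by omega))

theorem quarticF2_twistELS (hd : d.natAbs = p) (h0 : 0 < d) (h : d % 12 = 1) :
    quarticF2.TwistELS d := by
  have hd0 : d ≠ 0 := by omega
  refine twistELS_of_local hd (fun l _ => quarticF2_twistHasPoint) ?_ ?_ ?_ ?_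
  · exact twistHasPoint_real hd0 1 0 (by norm_num) (by norm_num [quarticF2]; omega)
  · have : d % 8 = 1 ∨ d % 8 = 5 := by omega
    rcases this with h | h
    · exact twistHasPoint_of_isSquare hd0 1 0 1 d (by norm_num) (by norm_num [quarticF2])
        (Padic.isSquare_intCast_two h)
    · exact twistHasPoint_of_isSquare hd0 1 1 1 (d * 733) (by norm_num) (by norm_num [quarticF2])
        (Padic.isSquare_intCast_two (by omega))
  · exact twistHasPoint_of_isSquare hd0 1 0 1 d (by norm_num) (by norm_num [quarticF2])
      (Padic.isSquare_intCast_three (by omega))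
  · obtain ⟨r, hr⟩ := Padic.isSquare_three (p := p) (by omega) (by omega) (by omega)
    obtain ⟨i, hi⟩ := Padic.isSquare_neg_one (p := p) (by omega) (by omega)
    -- F2 has the factor x² + 28 + 6√3 = x² + (1 + 3√3)².
    obtain ⟨x, hx⟩ : ∃ x, x = i * (1 + 3 * r) := ⟨_, rfl⟩
    have hfac : x ^ 2 = -28 - 6 * r := by
      rw [hx]
      linear_combination -(1 + 6 * r + 9 * r ^ 2) * hi + 9 * hr
    refine twistHasPoint_of_root x ?_
    simp only [form, quarticF2]
    push_cast
    linear_combination (x ^ 2 + 28 - 6 * r) * hfac - 36 * hr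

end Sufficiency

/-! ### Assembly of the local conditions -/

theorem proposition2p2 (p : ℕ) (hp : p.Prime) (d : ℤ) (hd : d = (p : ℤ) ∨ d = -(p : ℤ)) :
    (quarticH1.TwistELS d ↔ d ≡ 1 [ZMOD 12] ∨ d = -3) ∧
    (quarticH2.TwistELS d ↔ (0 < d ∧ d ≡ 1 [ZMOD 8]) ∨ d = 2) ∧
    (quarticF1.TwistELS d ↔ 0 < d ∧ (d ≡ 1 [ZMOD 8] ∨ d ≡ 3 [ZMOD 8])) ∧
    (quarticF2.TwistELS d ↔ 0 < d ∧ d ≡ 1 [ZMOD 12]) := by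
  have : Fact p.Prime := ⟨hp⟩
  have hd' : d.natAbs = p := by omega
  have hp0 := hp.pos
  have hd0 : d ≠ 0 := by omega
  have hodd := hp.eq_two_or_odd
  simp only [Int.ModEq, Int.reduceMod]
  refine ⟨⟨fun h => ?_, quarticH1_twistELS hd'⟩, ⟨fun h => ?_, quarticH2_twistELS hd'⟩,
    ⟨fun h => ?_, fun h => quarticF1_twistELS hd' h.1 h.2⟩,
    ⟨fun h => ?_, fun h => quarticF2_twistELS hd' h.1 h.2⟩⟩
  · have h4 := quarticH1_mod_four hd' (h.2 2)
    have h3 := quarticH1_isSquare_three hd' (h.2 p)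
    by_cases hp3 : p = 3
    · right; omega
    rw [ZMod.isSquare_three_iff (by omega) hp3] at h3
    omega
  · have hpos := quarticH2_pos h.1
    by_cases hp2 : p = 2
    · right; omega
    have h1 := quarticH2_isSquare_neg_one hp2 hd' (h.2 p)
    have h2 := quarticH2_isSquare_two hp2 hd' (h.2 p)
    rw [ZMod.exists_sq_eq_neg_one_iff] at h1
    rw [ZMod.exists_sq_eq_two_iff hp2] at h2
    omega
  · have hpos := quarticF1_pos h.1
    refine ⟨hpos, ?_⟩
    by_cases hp2 : p = 2
    · obtain rfl : d = 2 := by omega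
      exact absurd (h.2 2) quarticF1_not_twistHasPoint_two
    -- Here positivity gives d = 11, which is 3 mod 8 and so satisfies the conclusion directly.
    by_cases hp11 : p = 11
    · omega
    have h1 := quarticF1_isSquare_neg_two hp11 hd' (h.2 p)
    rw [ZMod.exists_sq_eq_neg_two_iff hp2] at h1
    omega
  · have hpos := quarticF2_pos h.1
    refine ⟨hpos, ?_⟩
    by_cases hp2 : p = 2
    · obtain rfl : d = 2 := by omega
      exact absurd (h.2 2) quarticF2_not_twistHasPoint_two
    have h1 := quarticF2_isSquare_neg_one hd' (h.2 p)
    rw [ZMod.exists_sq_eq_neg_one_iff] at h1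
    have h3 := quarticF2_isSquare_three hd' (h.2 p)
    by_cases hp3 : p = 3
    · omega
    rw [ZMod.isSquare_three_iff hp2 hp3] at h3
    omega
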